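/- Let $n,p,N_p,T$ be natural numbers, let $\hat A_k\in\mathbb R^{n\times n}$, $\hat B_k\in\mathbb R^{n\times p}$ ($k\ge 0$) and $\sigma_{\hat x},\sigma_{\hat u},\sigma_{\hat w}\ge 0$. Consider $N_p$ independent rollouts of length $T$ of the linear time-varying system $$\hat x^i_{k+1}=\hat A_k\hat x^i_k+\hat B_k\hat u^i_k+\hat w^i_k,\qquad 1\le i\le N_p,\ 0\le k<T,$$ where all the random vectors $\hat x^i_0\sim\mathcal N(0,\sigma_{\hat x}^2I_n)$, $\hat u^i_k\sim\mathcal N(0,\sigma_{\hat u}^2I_p)$, $\hat w^i_k\sim\mathcal N(0,\sigma_{\hat w}^2I_n)$ are mutually independent. Let $\hat z^i_k=\begin{bmatrix}\hat x^i_k\\ \hat u^i_k\end{bmatrix}\in\mathbb R^{n+p}$, $\hat W^i=[\hat w^i_{T-1}\ \cdots\ \hat w^i_0]$, $\hat Z^i=[\hat z^i_{T-1}\ \cdots\ \hat z^i_0]$, $\hat W=[\hat W^1\ \cdots\ \hat W^{N_p}]$, $\hat Z=[\hat Z^1\ \cdots\ \hat Z^{N_p}]$, and, for weights $q_0,\dots,q_{T-1}\ge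 0$, let $\mathcal Q=\mathrm{diag}(q_{T-1},\dots,q_0)$ and $\hat Q=\mathrm{diag}(\mathcal Q,\dots,\mathcal Q)\in\mathbb R^{N_pT\times N_pT}$. Put $\Phi(k,l)=\hat A_{k-1}\hat A_{k-2}\cdots\hat A_l$ for $k>l$, $\Phi(k,k)=I_n$, and $$\hat G_{k+1}=[\Phi(k,1)\hat B_0\ \ \Phi(k,2)\hat B_1\ \cdots\ \Phi(k,k)\hat B_{k-1}],\qquad \hat F_{k+1}=[\Phi(k,1)\ \ \Phi(k,2)\ \cdots\ \Phi(k,k)]$$ for $k\ge1$, with $\hat G_1=0$, $\hat F_1=0$, and let $$\hat\Sigma_k=\begin{bmatrix}\sigma_{\hat u}^2\hat G_{k+1}\hat G_{k+1}^*+\sigma_{\hat w}^2\hat F_{k+1}\hat F_{k+1}^*+\sigma_{\hat x}^2\Phi(k,0)\Phi(k,0)^*&0\\0&\sigma_{\hat u}^2I_p\end{bmatrix}$$ (the covariance matrix of $\hat z^i_k$). Let $\|\cdot\|$ be the spectral norm. Then for every $\delta>0$ (with $\delta\le\frac12$ in the case $T=1$) such that $N_p\ge(4n+2p)\log\frac T\delta$,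 with probability at least $1-\delta$, $$\|\hat W\hat Q\hat Z^*\|\le 4\sigma_{\hat w}\sqrt{N_p(2n+p)\log\frac{9T}\delta}\ \sum_{k=0}^{T-1}q_k\|\hat\Sigma_k^{1/2}\|.$$ -/

import Mathlib

open MeasureTheory ProbabilityTheory Matrix
open scoped Matrix.Norms.L2Operator MatrixOrder

noncomputable section

namespace AuxSysId

/-- The state transition matrix `Φ(k, l) = A_{k-1} A_{k-2} ⋯ A_l` for `k > l`, and `Φ(k, k) = I`. -/
def transition {n : ℕ} (A : ℕ → Matrix (Fin n) (Fin n) ℝ) : ℕ → ℕ → Matrix (Fin n) (Fin n) ℝ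
  | 0, _ => 1
  | k + 1, l => if l ≤ k then A k * transition A k l else 1

/-- The block row `[Φ(k,1) B_0, Φ(k,2) B_1, …, Φ(k,k) B_{k-1}]` with `k` blocks (empty for `k = 0`),
which maps the inputs `u_0, …, u_{k-1}` to their contribution to `x_k`. -/
def inputBlocks {n p : ℕ} (A : ℕ → Matrix (Fin n) (Fin n) ℝ) (B : ℕ → Matrix (Fin n) (Fin p) ℝ)
    (k : ℕ) : Matrix (Fin n) (Fin k × Fin p) ℝ :=
  Matrix.of fun a c => (transition A k (c.1 + 1) * B c.1) a c.2

/-- The block row `[Φ(k,1), Φ(k,2), …, Φ(k,k)]` with `k` blocks (empty for `k = 0`),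
which maps the noises `w_0, …, w_{k-1}` to their contribution to `x_k`. -/
def noiseBlocks {n : ℕ} (A : ℕ → Matrix (Fin n) (Fin n) ℝ)
    (k : ℕ) : Matrix (Fin n) (Fin k × Fin n) ℝ :=
  Matrix.of fun a c => transition A k (c.1 + 1) a c.2

/-- The covariance matrix `Σ_k` of the state-input pair `z_k = (x_k, u_k)`. -/
def covZ {n p : ℕ} (A : ℕ → Matrix (Fin n) (Fin n) ℝ) (B : ℕ → Matrix (Fin n) (Fin p) ℝ)
    (σx σu σw : ℝ) (k : ℕ) : Matrix (Fin n ⊕ Fin p) (Fin n ⊕ Fin p) ℝ :=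
  Matrix.fromBlocks
    (σu ^ 2 • (inputBlocks A B k * (inputBlocks A B k)ᴴ)
      + σw ^ 2 • (noiseBlocks A k * (noiseBlocks A k)ᴴ)
      + σx ^ 2 • (transition A k 0 * (transition A k 0)ᴴ))
    0 0 (σu ^ 2 • (1 : Matrix (Fin p) (Fin p) ℝ))

/-- `Σ_k` is positive semidefinite, so `CFC.sqrt Σ_k` is its positive semidefinite square root. -/
theorem covZ_posSemidef {n p : ℕ} (A : ℕ → Matrix (Fin n) (Fin n) ℝ)
    (B : ℕ → Matrix (Fin n) (Fin p) ℝ) (σx σu σw : ℝ) (k : ℕ) :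
    (covZ A B σx σu σw k).PosSemidef := by
  have h1 : (σu ^ 2 • (inputBlocks A B k * (inputBlocks A B k)ᴴ)
      + σw ^ 2 • (noiseBlocks A k * (noiseBlocks A k)ᴴ)
      + σx ^ 2 • (transition A k 0 * (transition A k 0)ᴴ)).PosSemidef :=
    (((Matrix.posSemidef_self_mul_conjTranspose _).smul (sq_nonneg σu)).add
      ((Matrix.posSemidef_self_mul_conjTranspose _).smul (sq_nonneg σw))).add
      ((Matrix.posSemidef_self_mul_conjTranspose _).smul (sq_nonneg σx))
  have h2 : (σu ^ 2 • (1 : Matrix (Fin p) (Fin p) ℝ)).PosSemidef :=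
    Matrix.PosSemidef.one.smul (sq_nonneg σu)
  refine Matrix.PosSemidef.of_dotProduct_mulVec_nonneg ?_ fun v => ?_
  · exact Matrix.IsHermitian.fromBlocks h1.1 (by simp) h2.1
  · have e1 := h1.dotProduct_mulVec_nonneg (v ∘ Sum.inl)
    have e2 := h2.dotProduct_mulVec_nonneg (v ∘ Sum.inr)
    have := add_nonneg e1 e2
    rw [covZ, Matrix.fromBlocks_mulVec]
    simpa [dotProduct, Fintype.sum_sum_type] using this

/-- Labels of the independent sources of randomness in `N` rollouts of length `T`: the initial
states `x_0^i`, the inputs `u_k^i` and the process noises `w_k^i`, for `i < N` and `k < T`. -/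
inductive Source (N T : ℕ) : Type
  | init (i : Fin N) : Source N T
  | input (i : Fin N) (k : Fin T) : Source N T
  | noise (i : Fin N) (k : Fin T) : Source N T

/-- The dimension of each source of randomness. -/
def Source.dim {N T : ℕ} (n p : ℕ) : Source N T → ℕ
  | .init _ => n
  | .input _ _ => p
  | .noise _ _ => n

/-- The random vector attached to each source of randomness. -/
def Source.vec {N T n p : ℕ} {Ω : Type*}
    (x₀ : Fin N → Ω → EuclideanSpace ℝ (Fin n))
    (u : Fin N → ℕ → Ω → EuclideanSpace ℝ (Fin p))
    (w : Fin N → ℕ → Ω → EuclideanSpace ℝ (Fin n)) :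
    (s : Source N T) → Ω → EuclideanSpace ℝ (Fin (s.dim n p))
  | .init i => x₀ i
  | .input i k => u i k
  | .noise i k => w i k

/-- The probabilistic assumptions on `N` independent rollouts of length `T`:
`x_0^i ∼ 𝒩(0, σx² I_n)`, `u_k^i ∼ 𝒩(0, σu² I_p)`, `w_k^i ∼ 𝒩(0, σw² I_n)`, and all of these random
vectors (over all rollouts `i < N` and times `k < T`) are mutually independent. -/
structure IsRolloutData {N n p : ℕ} {Ω : Type*} [MeasurableSpace Ω] (P : Measure Ω) (T : ℕ)
    (σx σu σw : ℝ)
    (x₀ : Fin N → Ω → EuclideanSpace ℝ (Fin n))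
    (u : Fin N → ℕ → Ω → EuclideanSpace ℝ (Fin p))
    (w : Fin N → ℕ → Ω → EuclideanSpace ℝ (Fin n)) : Prop where
  init_law : ∀ i, HasLaw (x₀ i)
    (multivariateGaussian 0 (σx ^ 2 • (1 : Matrix (Fin n) (Fin n) ℝ))) P
  input_law : ∀ i, ∀ k < T, HasLaw (u i k)
    (multivariateGaussian 0 (σu ^ 2 • (1 : Matrix (Fin p) (Fin p) ℝ))) P
  noise_law : ∀ i, ∀ k < T, HasLaw (w i k)
    (multivariateGaussian 0 (σw ^ 2 • (1 : Matrix (Fin n) (Fin n) ℝ))) P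
  indep : iIndepFun (Source.vec (T := T) x₀ u w) P

/-- The trajectory of `x_{k+1} = A_k x_k + B_k u_k + w_k` started at `x₀`. -/
def state {n p : ℕ} (A : ℕ → Matrix (Fin n) (Fin n) ℝ) (B : ℕ → Matrix (Fin n) (Fin p) ℝ)
    (x₀ : EuclideanSpace ℝ (Fin n)) (u : ℕ → EuclideanSpace ℝ (Fin p))
    (w : ℕ → EuclideanSpace ℝ (Fin n)) : ℕ → (Fin n → ℝ)
  | 0 => x₀.ofLp
  | k + 1 => A k *ᵥ state A B x₀ u w k + B k *ᵥ (u k).ofLp + (w k).ofLp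

/-- The batch noise matrix `W = [W¹ ⋯ W^N]` with `W^i = [w_{T-1}^i ⋯ w_0^i]`; the column `(i, j)`
is the `j`-th column of the `i`-th block (counted from `0`), that is, `w_{T-1-j}^i`. -/
def batchW {N n : ℕ} (T : ℕ) (w : Fin N → ℕ → EuclideanSpace ℝ (Fin n)) :
    Matrix (Fin n) (Fin N × Fin T) ℝ :=
  Matrix.of fun a c => w c.1 (c.2.rev : ℕ) a

/-- The batch data matrix `Z = [Z¹ ⋯ Z^N]` with `Z^i = [z_{T-1}^i ⋯ z_0^i]`, where `z_k^i` stacks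
the state `x_k^i` on top of the input `u_k^i`. -/
def batchZ {N n p : ℕ} (T : ℕ) (A : ℕ → Matrix (Fin n) (Fin n) ℝ)
    (B : ℕ → Matrix (Fin n) (Fin p) ℝ)
    (x₀ : Fin N → EuclideanSpace ℝ (Fin n)) (u : Fin N → ℕ → EuclideanSpace ℝ (Fin p))
    (w : Fin N → ℕ → EuclideanSpace ℝ (Fin n)) : Matrix (Fin n ⊕ Fin p) (Fin N × Fin T) ℝ :=
  Matrix.of fun a c => Sum.elim (state A B (x₀ c.1) (u c.1) (w c.1) (c.2.rev : ℕ))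
    (u c.1 (c.2.rev : ℕ)).ofLp a

/-- The weight matrix `diag(𝒬, …, 𝒬)` with `N` blocks `𝒬 = diag(q_{T-1}, …, q_0)`. -/
def batchQ (N T : ℕ) (q : ℕ → ℝ) : Matrix (Fin N × Fin T) (Fin N × Fin T) ℝ :=
  Matrix.diagonal fun c => q (c.2.rev : ℕ)

end AuxSysId

end

/-! The product `W Q Zᴴ` splits over time as the sum of `q k` times the matrix of sums over rollouts
of `w_k^i (z_k^i)ᵀ`. The triangle inequality and a union bound over the `T` times reduce the claim
to a fixed `k` with failure probability `ε = δ / T`.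

For fixed unit-ball vectors `x`, `y`, the bilinear form is `∑ i, a_i b_i` with `a_i = x ⬝ w_k^i` and
`b_i = y ⬝ z_k^i`. Since `z_k^i` involves only noises before time `k`, `a_i` and `b_i` are
independent centred Gaussians, with variances at most `σw ^ 2` and `‖Σ_k^{1/2}‖ ^ 2`. Integrating
out `b_i`, then `a_i`, gives the Laplace transform `(1 - t ^ 2 var(a) var(b)) ^ (-N / 2)` of the sum
(`lintegral_exp_chaos`), and Chernoff's bound controls its tail (`measure_bilinear_gt_le`).

Passing to the norm uses `1/4`-nets of the two unit balls: `9 ^ (2n + p)` pairs in all, at the cost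
of a factor `16 / 9`. A tail threshold with constant `9 / 4` on each pair thus gives the constant
`4`. The lower bound on `N` keeps the Chernoff exponent in a range where `9 / 4` suffices
(`exists_chernoff_exponent`). -/

namespace AuxSysId

/-! ### Nets of unit balls and operator norms -/

/-- A `1/4`-separated finite subset of the unit ball has at most `9 ^ dim` points. -/
theorem card_le_nine_pow_of_separated {E : Type*} [NormedAddCommGroup E] [NormedSpace ℝ E]
    [FiniteDimensional ℝ E] (s : Finset E) (hs : ∀ c ∈ s, ‖c‖ ≤ 1)
    (h : ∀ c ∈ s, ∀ d ∈ s, c ≠ d → 1 / 4 ≤ ‖c - d‖) : s.card ≤ 9 ^ Module.finrank ℝ E := by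
  borelize E
  let μ : Measure E := Measure.addHaar
  -- The balls of radius `1/8` are disjoint and lie in the ball of radius `9/8`, so comparing Haar
  -- measures gives a factor `9` per dimension.
  set A := ⋃ c ∈ s, Metric.ball (c : E) (1 / 8) with hA
  have D : Set.Pairwise (s : Set E) (Function.onFun Disjoint fun c =>
    Metric.ball (c : E) (1 / 8)) := by
    rintro c hc d hd hcd
    apply Metric.ball_disjoint_ball
    rw [dist_eq_norm]
    exact le_trans (by norm_num) (h c hc d hd hcd)
  have A_subset : A ⊆ Metric.ball (0 : E) (9 / 8) := by
    refine Set.iUnion₂_subset fun x hx => Metric.ball_subset_ball' ?_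
    rw [dist_zero_right]
    linarith [hs x hx]
  have I : (s.card : ENNReal) * ENNReal.ofReal ((1 / 8) ^ Module.finrank ℝ E) * μ (Metric.ball 0 1) ≤
      ENNReal.ofReal ((9 / 8) ^ Module.finrank ℝ E) * μ (Metric.ball 0 1) :=
    calc
      _ = μ A := by
        rw [hA, measure_biUnion_finset D fun c _ => measurableSet_ball]
        simp only [μ.addHaar_ball_of_pos _ (show (0 : ℝ) < 1 / 8 by norm_num)]
        simp only [Finset.sum_const, nsmul_eq_mul, mul_assoc]
      _ ≤ μ (Metric.ball (0 : E) (9 / 8)) := measure_mono A_subset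
      _ = _ := by
        simp only [μ.addHaar_ball_of_pos _ (show (0 : ℝ) < 9 / 8 by norm_num)]
  have J := (ENNReal.mul_le_mul_iff_left (Metric.measure_ball_pos μ (0 : E) zero_lt_one).ne'
    measure_ball_lt_top.ne).1 I
  have K : (s.card : ℝ) ≤ (9 : ℝ) ^ Module.finrank ℝ E := by
    have := ENNReal.toReal_le_of_le_ofReal (by positivity) J
    simpa [div_eq_mul_inv, mul_pow] using this
  exact mod_cast K

/-- The unit ball of a finite-dimensional space has a `1/4`-net with at most `9 ^ dim` points. -/
theorem exists_quarter_net (E : Type*) [NormedAddCommGroup E] [NormedSpace ℝ E]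
    [FiniteDimensional ℝ E] :
    ∃ C : Finset E, C.card ≤ 9 ^ Module.finrank ℝ E ∧ (∀ c ∈ C, ‖c‖ ≤ 1) ∧
      ∀ x : E, ‖x‖ ≤ 1 → ∃ c ∈ C, ‖x - c‖ ≤ 1 / 4 := by
  classical
  let good : Finset E → Prop := fun s =>
    (∀ c ∈ s, ‖c‖ ≤ 1) ∧ ∀ c ∈ s, ∀ d ∈ s, c ≠ d → 1 / 4 ≤ ‖c - d‖
  let p : ℕ → Prop := fun m => ∃ s : Finset E, good s ∧ s.card = m
  have hbound : ∀ s, good s → s.card ≤ 9 ^ Module.finrank ℝ E := fun s hs =>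
    card_le_nine_pow_of_separated s hs.1 hs.2
  have h0 : p 0 := ⟨∅, ⟨by simp, by simp⟩, rfl⟩
  -- A separated set of maximal cardinality is a net: a point farther than `1/4` from all of it
  -- could be added.
  obtain ⟨C, hC, hcard⟩ : p (Nat.findGreatest p (9 ^ Module.finrank ℝ E)) :=
    Nat.findGreatest_spec (Nat.zero_le _) h0
  refine ⟨C, hbound C hC, hC.1, fun x hx => ?_⟩
  by_contra! hfar
  have hxC : x ∉ C := fun hmem => by
    have := hfar x hmem
    simp at this
    linarith
  have hgood : good (insert x C) := by
    refine ⟨fun c hc => ?_, fun c hc d hd hcd => ?_⟩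
    · rcases Finset.mem_insert.1 hc with rfl | hc
      · exact hx
      · exact hC.1 c hc
    · rcases Finset.mem_insert.1 hc with hc' | hc' <;> rcases Finset.mem_insert.1 hd with hd' | hd'
      · exact absurd (hc'.trans hd'.symm) hcd
      · rw [hc']; exact (hfar d hd').le
      · rw [norm_sub_rev, hd']; exact (hfar c hc').le
      · exact hC.2 c hc' d hd' hcd
  have hle := Nat.le_findGreatest (hbound _ hgood) (show p _ from ⟨_, hgood, rfl⟩)
  rw [Finset.card_insert_of_notMem hxC, ← hcard] at hle
  omega

/-- The norm of a continuous linear map is controlled by its bilinear form on `1/4`-nets. -/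
theorem opNorm_le_of_quarter_nets {E F : Type*} [NormedAddCommGroup E] [InnerProductSpace ℝ E]
    [NormedAddCommGroup F] [InnerProductSpace ℝ F] (L : E →L[ℝ] F) (C : Finset E) (D : Finset F)
    (hC : ∀ x : E, ‖x‖ ≤ 1 → ∃ c ∈ C, ‖x - c‖ ≤ 1 / 4)
    (hD : ∀ x : F, ‖x‖ ≤ 1 → ∃ c ∈ D, ‖x - c‖ ≤ 1 / 4) {K : ℝ} (hK : 0 ≤ K)
    (h : ∀ x ∈ D, ∀ y ∈ C, inner ℝ x (L y) ≤ K) : ‖L‖ ≤ 16 / 9 * K := by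
  -- Replacing the direction of `L y` by a net point loses at most `‖L y‖ / 4`, so `3/4 * ‖L y‖ ≤
  -- K`.
  have h1 : ∀ y ∈ C, ‖L y‖ ≤ 4 / 3 * K := by
    intro y hy
    set f := L y with hf
    by_cases h0 : ‖f‖ = 0
    · rw [h0]; positivity
    obtain ⟨c, hc, hcd⟩ := hD ((‖f‖)⁻¹ • f) (by
      rw [norm_smul, norm_inv, norm_norm, inv_mul_cancel₀ h0])
    have e1 : inner ℝ ((‖f‖)⁻¹ • f) f = ‖f‖ := by
      rw [real_inner_smul_left, real_inner_self_eq_norm_sq]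
      field_simp
    have e2 : inner ℝ ((‖f‖)⁻¹ • f - c) f ≤ 1 / 4 * ‖f‖ :=
      (real_inner_le_norm _ _).trans (mul_le_mul_of_nonneg_right hcd (norm_nonneg _))
    rw [inner_sub_left, e1] at e2
    linarith [h c hc y hy]
  -- The same loss on the domain side; solving for `‖L‖` gives the second factor `4/3`.
  have h2 : ‖L‖ ≤ 4 / 3 * K + ‖L‖ * (1 / 4) := by
    refine L.opNorm_le_bound (by positivity) fun x => ?_
    by_cases h0 : ‖x‖ = 0
    · have : x = 0 := norm_eq_zero.1 h0
      simp [this]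
    obtain ⟨c, hc, hcd⟩ := hC ((‖x‖)⁻¹ • x) (by
      rw [norm_smul, norm_inv, norm_norm, inv_mul_cancel₀ h0])
    have e1 : ‖L ((‖x‖)⁻¹ • x)‖ ≤ 4 / 3 * K + ‖L‖ * (1 / 4) := by
      have e3 : L ((‖x‖)⁻¹ • x) = L c + L ((‖x‖)⁻¹ • x - c) := by rw [map_sub]; abel
      rw [e3]
      refine (norm_add_le _ _).trans (add_le_add (h1 c hc) ?_)
      exact (L.le_opNorm _).trans (mul_le_mul_of_nonneg_left hcd (norm_nonneg _))
    rw [map_smul, norm_smul, norm_inv, norm_norm] at e1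
    have hpos : 0 < ‖x‖ := lt_of_le_of_ne (norm_nonneg _) (Ne.symm h0)
    rwa [inv_mul_le_iff₀ hpos, mul_comm] at e1
  linarith

/-! ### Choice of the Chernoff exponent -/

/-- The exponent chosen in the Chernoff bound, in normalized form. -/
theorem exists_chernoff_exponent {r : ℝ} (hr : 0 < r) (hr2 : r ^ 2 ≤ 21 / 10) :
    ∃ θ : ℝ, 0 < θ ∧ θ < 1 ∧ -(1 / 2) * Real.log (1 - θ ^ 2) + r ^ 2 ≤ 9 / 4 * θ * r := by
  rcases lt_or_ge r (1 / 2) with h | h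
  -- For small `r`, `-log (1 - r ^ 2) / 2 ≤ 2/3 * r ^ 2`, and `2/3 + 1 ≤ 9/4`.
  · refine ⟨r, hr, by linarith, ?_⟩
    have hx : r ^ 2 ≤ 1 / 4 := by nlinarith
    have h1 := Real.one_sub_inv_le_log_of_pos (show 0 < 1 - r ^ 2 by linarith)
    have h2 : (1 - r ^ 2)⁻¹ ≤ 1 + 4 / 3 * r ^ 2 := by
      rw [inv_le_iff_one_le_mul₀ (by linarith)]
      nlinarith [sq_nonneg r]
    nlinarith [sq_nonneg r]
  -- With `θ` constant it suffices that `13/20 + r ^ 2 ≤ 153/80 * r`, a quadratic inequality valid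
  -- on `[1/2, 29/20]`.
  · refine ⟨17 / 20, by norm_num, by norm_num, ?_⟩
    have hr3 : r ≤ 29 / 20 := by nlinarith
    have hlog : -(13 / 10) ≤ Real.log (1 - (17 / 20 : ℝ) ^ 2) := by
      rw [Real.le_log_iff_exp_le (by norm_num)]
      -- Tenth powers turn the exponent into an integer, so that a decimal lower bound for `e`
      -- suffices.
      have h10 : Real.exp (-(13 / 10)) ^ 10 = (Real.exp 1 ^ 13)⁻¹ := by
        rw [← Real.exp_nat_mul, ← Real.exp_nat_mul, ← Real.exp_neg]
        norm_num
      have he : (2.7182818283 : ℝ) ^ 13 ≤ Real.exp 1 ^ 13 :=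
        pow_le_pow_left₀ (by norm_num) Real.exp_one_gt_d9.le 13
      refine le_of_pow_le_pow_left₀ (n := 10) (by norm_num) (by norm_num) ?_
      rw [h10]
      refine (inv_anti₀ (by norm_num) he).trans ?_
      norm_num
    nlinarith

/-- Equivalent to `9 ^ 5 ≤ 2 ^ 16`; it bounds `log (9 / ε)` by a multiple of `log (1 / ε)` when `ε ≤
1/2`. -/
theorem log_nine_le : Real.log 9 ≤ 16 / 5 * Real.log 2 := by
  have h : Real.log ((9 : ℝ) ^ 5) ≤ Real.log ((2 : ℝ) ^ 16) :=
    Real.log_le_log (by norm_num) (by norm_num)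
  rw [Real.log_pow, Real.log_pow] at h
  push_cast at h
  linarith

/-- The Chernoff bound, multiplied by the cardinality of the nets, is at most the failure
probability `ε`. -/
theorem exists_exponent_net_bound {N D : ℕ} (hD : 1 ≤ D) {ε : ℝ} (hε : 0 < ε) (hε2 : ε ≤ 1 / 2)
    (hN : 2 * (D : ℝ) * Real.log (1 / ε) ≤ N) :
    ∃ θ : ℝ, 0 < θ ∧ θ < 1 ∧
      9 ^ D * (Real.exp (-(θ * (9 / 4 * √((N : ℝ) * D * Real.log (9 / ε))))) *
        ((√(1 - θ ^ 2))⁻¹) ^ N) ≤ ε := by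
  have hDpos : (1 : ℝ) ≤ D := by exact_mod_cast hD
  set L := Real.log (1 / ε) with hL
  have hL2 : Real.log 2 ≤ L := Real.log_le_log (by norm_num) (by
    rw [le_div_iff₀ hε]; linarith)
  have hl2 : 0 < Real.log 2 := Real.log_pos (by norm_num)
  have hLpos : 0 < L := by linarith
  have hNpos : (0 : ℝ) < N := lt_of_lt_of_le (by positivity) hN
  have hℓ : Real.log (9 / ε) = Real.log 9 + L := by
    rw [hL, ← Real.log_mul (by norm_num) (by positivity)]
    congr 1
    ring
  have h9 : 0 < Real.log 9 := Real.log_pos (by norm_num)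
  set ℓ := Real.log (9 / ε) with hℓdef
  have hℓpos : 0 < ℓ := by linarith
  -- In this scale the threshold is `9/4 * N * r` and the net entropy together with `log (1 / ε)` is
  -- at most `N * r ^ 2`, so `N` factors out of the exponent.
  set r := √(D * ℓ / N) with hr
  have hrpos : 0 < r := Real.sqrt_pos.2 (by positivity)
  have hrsq : r ^ 2 = D * ℓ / N := Real.sq_sqrt (by positivity)
  have hr2 : r ^ 2 ≤ 21 / 10 := by
    rw [hrsq, div_le_iff₀ hNpos]
    have h1 : ℓ ≤ 21 / 5 * L := by
      have := log_nine_le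
      linarith
    calc (D : ℝ) * ℓ ≤ D * (21 / 5 * L) := by gcongr
      _ = 21 / 10 * (2 * D * L) := by ring
      _ ≤ 21 / 10 * N := by gcongr
  have hsqrt : √((N : ℝ) * D * ℓ) = N * r := by
    rw [Real.sqrt_eq_iff_eq_sq (by positivity) (by positivity), mul_pow, hrsq]
    field_simp
  obtain ⟨θ, hθ0, hθ1, hθ⟩ := exists_chernoff_exponent hrpos hr2
  refine ⟨θ, hθ0, hθ1, ?_⟩
  have hpos : 0 < 1 - θ ^ 2 := by nlinarith
  have hspos : 0 < √(1 - θ ^ 2) := Real.sqrt_pos.2 hpos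
  rw [← Real.log_le_log_iff (by positivity) hε, Real.log_mul (by positivity) (by positivity),
    Real.log_mul (by positivity) (by positivity), Real.log_exp, Real.log_pow, Real.log_pow,
    Real.log_inv, Real.log_sqrt hpos.le, hsqrt]
  have hεL : Real.log ε = -L := by rw [hL, one_div, Real.log_inv, neg_neg]
  rw [hεL]
  have hmul : (N : ℝ) * (-(1 / 2) * Real.log (1 - θ ^ 2) + r ^ 2) ≤ N * (9 / 4 * θ * r) :=
    mul_le_mul_of_nonneg_left hθ hNpos.le
  have hNr : (N : ℝ) * r ^ 2 = D * ℓ := by rw [hrsq]; field_simp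
  have hDL : L ≤ D * L := by nlinarith
  rw [mul_add, hNr, hℓ] at hmul
  nlinarith

/-! ### Laplace transforms of Gaussian variables and their squares -/

section Gaussian

variable {Ω : Type*} [MeasurableSpace Ω] {P : Measure Ω}

theorem lintegral_exp_mul_of_hasLaw_gaussian {Y : Ω → ℝ} {v : NNReal}
    (hY : HasLaw Y (gaussianReal 0 v) P) (t : ℝ) :
    ∫⁻ ω, ENNReal.ofReal (Real.exp (t * Y ω)) ∂P = ENNReal.ofReal (Real.exp (v * t ^ 2 / 2)) := by
  rw [hY.lintegral_comp (f := fun y => ENNReal.ofReal (Real.exp (t * y))) (by fun_prop),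
    ← ofReal_integral_eq_lintegral_ofReal (integrable_exp_mul_gaussianReal t)
      (ae_of_all _ fun _ => (Real.exp_pos _).le)]
  have := congrFun (mgf_fun_id_gaussianReal (μ := 0) (v := v)) t
  rw [mgf] at this
  rw [this, zero_mul, zero_add]

/-- The factor `exp (c * y ^ 2)` only changes the coefficient in the Gaussian density, which stays
integrable because `2 * c * v < 1`. Zero variance is separate, there being no density. -/
theorem lintegral_exp_mul_sq_of_hasLaw_gaussian {Y : Ω → ℝ} {v : NNReal}
    (hY : HasLaw Y (gaussianReal 0 v) P) {c : ℝ} (hcv : 2 * c * v < 1) :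
    ∫⁻ ω, ENNReal.ofReal (Real.exp (c * Y ω ^ 2)) ∂P =
      ENNReal.ofReal (√(1 - 2 * c * v))⁻¹ := by
  rw [hY.lintegral_comp (f := fun y => ENNReal.ofReal (Real.exp (c * y ^ 2))) (by fun_prop)]
  by_cases hv : v = 0
  · subst hv
    simp
  have hvpos : (0 : ℝ) < v := by positivity
  have hb : 0 < 1 / (2 * v) - c := by
    rw [sub_pos, lt_div_iff₀ (by positivity)]
    linarith
  have hfun : ∀ x, (√(2 * Real.pi * v))⁻¹ * Real.exp (-(1 / (2 * v) - c) * x ^ 2) =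
      gaussianPDFReal 0 v x * Real.exp (c * x ^ 2) := fun x => by
    rw [gaussianPDFReal, mul_assoc (√(2 * Real.pi * v))⁻¹, ← Real.exp_add]
    congr 2
    field_simp
    ring
  rw [gaussianReal_of_var_ne_zero 0 hv, lintegral_withDensity_eq_lintegral_mul _
    (measurable_gaussianPDF 0 v) (by fun_prop)]
  simp only [Pi.mul_apply, gaussianPDF, ← ENNReal.ofReal_mul (gaussianPDFReal_nonneg 0 v _),
    ← hfun]
  rw [← ofReal_integral_eq_lintegral_ofReal ((integrable_exp_neg_mul_sq hb).const_mul _)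
    (ae_of_all _ fun _ => by positivity), integral_const_mul, integral_gaussian]
  congr 1
  rw [← Real.sqrt_inv, ← Real.sqrt_inv, ← Real.sqrt_mul (by positivity)]
  congr 1
  have h1 : (1 : ℝ) - 2 * c * v ≠ 0 := by linarith
  have h2 : 1 / (2 * (v : ℝ)) - c = (1 - 2 * c * v) / (2 * v) := by field_simp
  rw [h2]
  field_simp

end Gaussian

/-! ### Independent blocks and the Gaussian chaos -/

section Independence

variable {Ω : Type*} [MeasurableSpace Ω] {P : Measure Ω}

/-- Nonnegative functions of disjoint blocks of an independent family: the expectation of the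
product is the product of the expectations. -/
theorem lintegral_prod_blocks {ι I : Type*} {β : ι → Type*} [∀ s, MeasurableSpace (β s)]
    {Y : (s : ι) → Ω → β s} (hY : iIndepFun Y P) (hYm : ∀ s, AEMeasurable (Y s) P)
    (S : I → Finset ι) (hS : Pairwise (Function.onFun Disjoint S))
    (g : (i : I) → ((s : S i) → β s) → ENNReal) (hg : ∀ i, Measurable (g i)) (F : Finset I) :
    ∫⁻ ω, ∏ i ∈ F, g i (fun s => Y s ω) ∂P = ∏ i ∈ F, ∫⁻ ω, g i (fun s => Y s ω) ∂P := by
  classical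
  have : IsProbabilityMeasure P := hY.isProbabilityMeasure
  have hgm : ∀ i, AEMeasurable (fun ω => g i (fun s => Y s ω)) P := fun i =>
    (hg i).comp_aemeasurable (aemeasurable_pi_lambda _ fun s => hYm s)
  induction F using Finset.induction_on with
  | empty => simp
  | insert i F hi ih =>
    simp only [Finset.prod_insert hi, ← ih]
    refine lintegral_mul_eq_lintegral_mul_lintegral_of_indepFun'' (hgm i)
      (Finset.aemeasurable_fun_prod _ fun j _ => hgm j) ?_
    have hdisj : Disjoint (S i) (F.biUnion S) := by
      rw [Finset.disjoint_biUnion_right]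
      exact fun j hj => hS (fun h => hi (h ▸ hj))
    have hind := hY.indepFun_finset₀ (S i) (F.biUnion S) hdisj hYm
    have hmem : ∀ j : F, ∀ s : S j, (s : ι) ∈ F.biUnion S := fun j s =>
      Finset.mem_biUnion.2 ⟨j, j.2, s.2⟩
    have hG : Measurable fun z : (s : F.biUnion S) → β s =>
        ∏ j ∈ F.attach, g j (fun s => z ⟨s, hmem j s⟩) :=
      Finset.measurable_fun_prod _ fun j _ => (hg j).comp
        (measurable_pi_lambda _ fun s => measurable_pi_apply _)
    have hprod : (fun ω => ∏ j ∈ F, g j (fun s => Y s ω)) =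
        (fun z : (s : F.biUnion S) → β s => ∏ j ∈ F.attach, g j (fun s => z ⟨s, hmem j s⟩)) ∘
          fun ω s => Y s ω :=
      funext fun a => (Finset.prod_attach F fun j => g j (fun s => Y s a)).symm
    rw [hprod]
    exact hind.comp (hg i) hG

/-- The Laplace transform of a Gaussian bilinear chaos `∑ i, a i * b i`, where the `a i` and the
summands of the `b i` are independent centred Gaussian variables. -/
theorem lintegral_exp_chaos {I J : Type*} [Fintype I] [Fintype J] {Y : I → Option J → Ω → ℝ}
    {v : Option J → NNReal} (hY : iIndepFun (fun p : I × Option J => Y p.1 p.2) P)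
    (hlaw : ∀ i j, HasLaw (Y i j) (gaussianReal 0 (v j)) P) {t : ℝ}
    (ht : t ^ 2 * v none * (∑ j, v (some j)) < 1) :
    ∫⁻ ω, ENNReal.ofReal (Real.exp (t * ∑ i, Y i none ω * ∑ j, Y i (some j) ω)) ∂P =
      ENNReal.ofReal (√(1 - t ^ 2 * v none * (∑ j, v (some j))))⁻¹ ^ Fintype.card I := by
  classical
  have : IsProbabilityMeasure P := hY.isProbabilityMeasure
  have hm : ∀ p : I × Option J, AEMeasurable (Y p.1 p.2) P := fun p => (hlaw _ _).aemeasurable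
  have hblock := lintegral_prod_blocks hY hm (fun i : I => {i} ×ˢ Finset.univ)
    (fun i j hij => Finset.disjoint_left.2 fun p hp hp' => hij (by
      simp only [Finset.mem_product, Finset.mem_singleton] at hp hp'
      exact hp.1.symm.trans hp'.1))
    (fun i z => ENNReal.ofReal (Real.exp (t * (z ⟨(i, none), by simp⟩ *
      ∑ j, z ⟨(i, some j), by simp⟩)))) (fun i => by fun_prop) Finset.univ
  have hlhs : ∀ ω, ENNReal.ofReal (Real.exp (t * ∑ i, Y i none ω * ∑ j, Y i (some j) ω)) =
      ∏ i, ENNReal.ofReal (Real.exp (t * (Y i none ω * ∑ j, Y i (some j) ω))) := fun ω => by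
    rw [Finset.mul_sum, Real.exp_sum, ENNReal.ofReal_prod_of_nonneg fun _ _ => (Real.exp_pos _).le]
  simp only [hlhs]
  refine hblock.trans ?_
  rw [← Finset.card_univ]
  refine Finset.prod_eq_pow_card fun i _ => ?_
  have hb : ∀ x : ℝ, ∫⁻ ω, ENNReal.ofReal (Real.exp (x * ∑ j, Y i (some j) ω)) ∂P =
      ENNReal.ofReal (Real.exp ((∑ j, (v (some j) : ℝ)) * x ^ 2 / 2)) := fun x => by
    have h1 := lintegral_prod_blocks hY hm (fun j : J => {(i, some j)})
      (fun j j' hj => by simpa [Function.onFun] using hj)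
      (fun j z => ENNReal.ofReal (Real.exp (x * z ⟨(i, some j), by simp⟩)))
      (fun i => by fun_prop) Finset.univ
    have h2 : ∀ ω, ENNReal.ofReal (Real.exp (x * ∑ j, Y i (some j) ω)) =
        ∏ j, ENNReal.ofReal (Real.exp (x * Y i (some j) ω)) := fun ω => by
      rw [Finset.mul_sum, Real.exp_sum,
        ENNReal.ofReal_prod_of_nonneg fun _ _ => (Real.exp_pos _).le]
    simp only [h2]
    refine h1.trans ?_
    simp only [lintegral_exp_mul_of_hasLaw_gaussian (hlaw i _) x]
    rw [← ENNReal.ofReal_prod_of_nonneg fun _ _ => (Real.exp_pos _).le, ← Real.exp_sum,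
      Finset.sum_mul, Finset.sum_div]
  have hind : IndepFun (Y i none) (fun ω => ∑ j, Y i (some j) ω) P := by
    have h1 := hY.indepFun_finset₀ {(i, none)} (Finset.univ.image fun j : J => (i, some j))
      (by simp) hm
    exact h1.comp (φ := fun z : (_ : ({(i, none)} : Finset (I × Option J))) → ℝ =>
        z ⟨(i, none), by simp⟩)
      (ψ := fun z : (_ : (Finset.univ.image fun j : J => (i, some j))) → ℝ =>
        ∑ j, z ⟨(i, some j), by simp⟩) (by fun_prop) (by fun_prop)
  have hbm : AEMeasurable (fun ω => ∑ j, Y i (some j) ω) P :=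
    Finset.aemeasurable_fun_sum _ fun j _ => hm (i, some j)
  have hprod := hind.map_prod_eq_prod_map_map (hm (i, none)) hbm
  have hf : Measurable fun z : ℝ × ℝ => ENNReal.ofReal (Real.exp (t * (z.1 * z.2))) := by fun_prop
  have : IsProbabilityMeasure (P.map fun ω => ∑ j, Y i (some j) ω) :=
    Measure.isProbabilityMeasure_map hbm
  -- For fixed `a`, integrating out the sum `b` leaves the exponential of a multiple of `a ^ 2`,
  -- whose Gaussian integral is the inverse square root.
  calc ∫⁻ ω, ENNReal.ofReal (Real.exp (t * (Y i none ω * ∑ j, Y i (some j) ω))) ∂P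
      = ∫⁻ z, ENNReal.ofReal (Real.exp (t * (z.1 * z.2)))
          ∂(P.map fun ω => (Y i none ω, ∑ j, Y i (some j) ω)) := by
        rw [lintegral_map' hf.aemeasurable ((hm (i, none)).prodMk hbm)]
    _ = ∫⁻ a, ENNReal.ofReal (Real.exp ((∑ j, (v (some j) : ℝ)) * (t * a) ^ 2 / 2))
          ∂(P.map (Y i none)) := by
        rw [hprod, lintegral_prod _ hf.aemeasurable]
        refine lintegral_congr fun a => ?_
        rw [lintegral_map' (by fun_prop) hbm, ← hb]
        simp only [mul_assoc]
    _ = ∫⁻ ω, ENNReal.ofReal (Real.exp (((∑ j, (v (some j) : ℝ)) * t ^ 2 / 2) * Y i none ω ^ 2))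
          ∂P := by
        rw [lintegral_map' (by fun_prop) (hm (i, none))]
        refine lintegral_congr fun a => ?_
        ring_nf
    _ = _ := by
        have e : 2 * ((∑ j, (v (some j) : ℝ)) * t ^ 2 / 2) * v none =
            t ^ 2 * v none * (∑ j, (v (some j) : ℝ)) := by ring
        rw [lintegral_exp_mul_sq_of_hasLaw_gaussian (hlaw i none) (by rw [e]; exact_mod_cast ht), e]
        push_cast
        rfl

end Independence

/-- Chernoff's bound for a variable whose Laplace transform is dominated by that of a Gaussian
chaos at scale `s`, with a strict inequality so that `s = 0` is allowed. -/
theorem measure_lt_le_of_chaos {Ω : Type*} [MeasurableSpace Ω] {P : Measure Ω} {S : Ω → ℝ}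
    (hS : AEMeasurable S P) {s : ℝ} (hs : 0 ≤ s) {N : ℕ}
    (hmgf : ∀ t, (t * s) ^ 2 < 1 → ∫⁻ ω, ENNReal.ofReal (Real.exp (t * S ω)) ∂P ≤
      ENNReal.ofReal ((√(1 - (t * s) ^ 2))⁻¹ ^ N))
    {θ τ : ℝ} (hθ : 0 < θ) (hθ1 : θ < 1) (hτ : 0 < τ) :
    P {ω | τ * s < S ω} ≤
      ENNReal.ofReal (Real.exp (-(θ * τ)) * (√(1 - θ ^ 2))⁻¹ ^ N) := by
  -- A scale `s' > s` is positive even if `s = 0`, so `t = θ / s'` makes sense and `t * s ≤ θ`.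
  -- Letting `s'` decrease to `s` recovers the strict event by continuity from below.
  have key : ∀ s', s < s' → P {ω | τ * s' ≤ S ω} ≤
      ENNReal.ofReal (Real.exp (-(θ * τ)) * (√(1 - θ ^ 2))⁻¹ ^ N) := by
    intro s' hs'
    have hs'0 : 0 < s' := hs.trans_lt hs'
    have hle : (θ / s' * s) ^ 2 ≤ θ ^ 2 := by
      refine pow_le_pow_left₀ (by positivity) ?_ 2
      rw [div_mul_eq_mul_div, div_le_iff₀ hs'0]
      gcongr
    have hθ2 : θ ^ 2 < 1 := by nlinarith
    have h1 := hmgf (θ / s') (hle.trans_lt hθ2)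
    have h2 : (√(1 - (θ / s' * s) ^ 2))⁻¹ ^ N ≤ (√(1 - θ ^ 2))⁻¹ ^ N := by
      have : 0 < √(1 - θ ^ 2) := Real.sqrt_pos.2 (by linarith)
      gcongr
    have h3 := mul_meas_ge_le_lintegral₀ (μ := P)
      (f := fun ω => ENNReal.ofReal (Real.exp (θ / s' * S ω))) (by fun_prop)
      (ENNReal.ofReal (Real.exp (θ * τ)))
    have h4 : {ω | τ * s' ≤ S ω} ⊆ {ω | ENNReal.ofReal (Real.exp (θ * τ)) ≤
        ENNReal.ofReal (Real.exp (θ / s' * S ω))} := fun ω hω => by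
      refine ENNReal.ofReal_le_ofReal (Real.exp_le_exp.2 ?_)
      calc θ * τ = θ / s' * (τ * s') := by field_simp
        _ ≤ θ / s' * S ω := mul_le_mul_of_nonneg_left hω (by positivity)
    rw [ENNReal.ofReal_mul (Real.exp_pos _).le, Real.exp_neg,
      ENNReal.ofReal_inv_of_pos (Real.exp_pos _), mul_comm _⁻¹, ← div_eq_mul_inv,
      ENNReal.le_div_iff_mul_le (Or.inl (by simp [Real.exp_pos])) (Or.inl ENNReal.ofReal_ne_top),
      mul_comm]
    exact ((mul_le_mul_right (measure_mono h4) _).trans h3).trans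
      (h1.trans (ENNReal.ofReal_le_ofReal h2))
  have hsub : {ω | τ * s < S ω} ⊆ ⋃ m : ℕ, {ω | τ * (s + 1 / ((m : ℝ) + 1)) ≤ S ω} := by
    intro ω hω
    obtain ⟨m, hm⟩ := exists_nat_one_div_lt (show 0 < (S ω - τ * s) / τ from
      div_pos (sub_pos.2 hω) hτ)
    rw [lt_div_iff₀ hτ] at hm
    refine Set.mem_iUnion.2 ⟨m, ?_⟩
    change τ * (s + 1 / ((m : ℝ) + 1)) ≤ S ω
    linarith
  have hmono : Monotone fun m : ℕ => {ω | τ * (s + 1 / ((m : ℝ) + 1)) ≤ S ω} := by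
    intro a b hab ω hω
    change τ * (s + 1 / ((b : ℝ) + 1)) ≤ S ω
    refine le_trans ?_ hω
    gcongr
  refine (measure_mono hsub).trans ?_
  rw [hmono.measure_iUnion]
  exact iSup_le fun m => key _ (by linarith [show 0 < 1 / ((m : ℝ) + 1) by positivity])

/-! ### State and covariance in terms of the sources -/

theorem transition_self {n : ℕ} (A : ℕ → Matrix (Fin n) (Fin n) ℝ) (k : ℕ) :
    transition A k k = 1 := by
  cases k <;> simp [transition]

theorem transition_succ {n : ℕ} (A : ℕ → Matrix (Fin n) (Fin n) ℝ) {k l : ℕ} (h : l ≤ k) :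
    transition A (k + 1) l = A k * transition A k l := by
  simp [transition, h]

/-- Variation of constants: the state is a linear function of the sources of randomness. -/
theorem state_eq {n p : ℕ} (A : ℕ → Matrix (Fin n) (Fin n) ℝ) (B : ℕ → Matrix (Fin n) (Fin p) ℝ)
    (x₀ : EuclideanSpace ℝ (Fin n)) (u : ℕ → EuclideanSpace ℝ (Fin p))
    (w : ℕ → EuclideanSpace ℝ (Fin n)) (k : ℕ) :
    state A B x₀ u w k = transition A k 0 *ᵥ x₀.ofLp
      + ∑ l : Fin k, (transition A k (l + 1) * B l) *ᵥ (u l).ofLp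
      + ∑ l : Fin k, transition A k (l + 1) *ᵥ (w l).ofLp := by
  induction k with
  | zero => simp [state, transition]
  | succ k ih =>
    have h1 : ∀ l : Fin k, transition A (k + 1) (l + 1) = A k * transition A k (l + 1) :=
      fun l => transition_succ A l.2
    simp only [Fin.sum_univ_castSucc, Fin.val_castSucc, Fin.val_last, transition_self, h1,
      transition_succ A (Nat.zero_le k), state, ih, mulVec_add, mulVec_sum, mulVec_mulVec,
      Matrix.mul_assoc, Matrix.one_mul, one_mulVec]
    abel

/-- A linear functional of the state-input pair, expanded over the sources of randomness. -/
theorem dotProduct_state_input {n p : ℕ} (A : ℕ → Matrix (Fin n) (Fin n) ℝ)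
    (B : ℕ → Matrix (Fin n) (Fin p) ℝ) (x₀ : EuclideanSpace ℝ (Fin n))
    (u : ℕ → EuclideanSpace ℝ (Fin p)) (w : ℕ → EuclideanSpace ℝ (Fin n)) (k : ℕ)
    (y : Fin n ⊕ Fin p → ℝ) :
    y ⬝ᵥ Sum.elim (state A B x₀ u w k) (u k).ofLp =
      ((y ∘ Sum.inl) ᵥ* transition A k 0) ⬝ᵥ x₀.ofLp + ((y ∘ Sum.inr) ⬝ᵥ (u k).ofLp
      + (∑ l : Fin k, ((y ∘ Sum.inl) ᵥ* (transition A k (l + 1) * B l)) ⬝ᵥ (u l).ofLp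
      + ∑ l : Fin k, ((y ∘ Sum.inl) ᵥ* transition A k (l + 1)) ⬝ᵥ (w l).ofLp)) := by
  have h : y ⬝ᵥ Sum.elim (state A B x₀ u w k) (u k).ofLp =
      (y ∘ Sum.inl) ⬝ᵥ state A B x₀ u w k + (y ∘ Sum.inr) ⬝ᵥ (u k).ofLp := by
    simp [dotProduct, Fintype.sum_sum_type]
  rw [h, state_eq]
  simp only [dotProduct_add, dotProduct_sum, dotProduct_mulVec]
  ring

theorem dotProduct_mul_conjTranspose_mulVec {m l : Type*} [Fintype m] [Fintype l]
    (M : Matrix m l ℝ) (y : m → ℝ) :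
    y ⬝ᵥ ((M * Mᴴ) *ᵥ y) = (y ᵥ* M) ⬝ᵥ (y ᵥ* M) := by
  rw [← mulVec_mulVec, dotProduct_mulVec, conjTranspose_eq_transpose_of_trivial, mulVec_transpose]

/-- The quadratic form of the covariance matrix is the sum of the variances contributed by the
sources of randomness. -/
theorem dotProduct_covZ_mulVec {n p : ℕ} (A : ℕ → Matrix (Fin n) (Fin n) ℝ)
    (B : ℕ → Matrix (Fin n) (Fin p) ℝ) (σx σu σw : ℝ) (k : ℕ) (y : Fin n ⊕ Fin p → ℝ) :
    y ⬝ᵥ (covZ A B σx σu σw k *ᵥ y) =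
      σx ^ 2 * (((y ∘ Sum.inl) ᵥ* transition A k 0) ⬝ᵥ ((y ∘ Sum.inl) ᵥ* transition A k 0))
      + (σu ^ 2 * ((y ∘ Sum.inr) ⬝ᵥ (y ∘ Sum.inr))
      + (∑ l : Fin k, σu ^ 2 * (((y ∘ Sum.inl) ᵥ* (transition A k (l + 1) * B l)) ⬝ᵥ
          ((y ∘ Sum.inl) ᵥ* (transition A k (l + 1) * B l)))
      + ∑ l : Fin k, σw ^ 2 * (((y ∘ Sum.inl) ᵥ* transition A k (l + 1)) ⬝ᵥ
          ((y ∘ Sum.inl) ᵥ* transition A k (l + 1))))) := by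
  have hblock : y ⬝ᵥ (covZ A B σx σu σw k *ᵥ y) =
      (y ∘ Sum.inl) ⬝ᵥ ((σu ^ 2 • (inputBlocks A B k * (inputBlocks A B k)ᴴ)
        + σw ^ 2 • (noiseBlocks A k * (noiseBlocks A k)ᴴ)
        + σx ^ 2 • (transition A k 0 * (transition A k 0)ᴴ)) *ᵥ (y ∘ Sum.inl))
      + (y ∘ Sum.inr) ⬝ᵥ ((σu ^ 2 • (1 : Matrix (Fin p) (Fin p) ℝ)) *ᵥ (y ∘ Sum.inr)) := by
    rw [covZ, fromBlocks_mulVec]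
    simp [dotProduct, Fintype.sum_sum_type]
  have hin : ((y ∘ Sum.inl) ᵥ* inputBlocks A B k) ⬝ᵥ ((y ∘ Sum.inl) ᵥ* inputBlocks A B k) =
      ∑ l : Fin k, ((y ∘ Sum.inl) ᵥ* (transition A k (l + 1) * B l)) ⬝ᵥ
          ((y ∘ Sum.inl) ᵥ* (transition A k (l + 1) * B l)) := by
    rw [dotProduct, Fintype.sum_prod_type]
    rfl
  have hno : ((y ∘ Sum.inl) ᵥ* noiseBlocks A k) ⬝ᵥ ((y ∘ Sum.inl) ᵥ* noiseBlocks A k) =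
      ∑ l : Fin k, ((y ∘ Sum.inl) ᵥ* transition A k (l + 1)) ⬝ᵥ
          ((y ∘ Sum.inl) ᵥ* transition A k (l + 1)) := by
    rw [dotProduct, Fintype.sum_prod_type]
    rfl
  rw [hblock]
  simp only [add_mulVec, smul_mulVec, dotProduct_add, dotProduct_smul,
    dotProduct_mul_conjTranspose_mulVec, hin, hno, one_mulVec, smul_eq_mul, Finset.mul_sum]
  ring

/-- The quadratic form of `S` at `y` is the squared norm of its square root applied to `y`. -/
theorem dotProduct_mulVec_le_norm_sqrt_sq {m : Type*} [Fintype m] [DecidableEq m]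
    {S : Matrix m m ℝ} (hS : S.PosSemidef) (y : EuclideanSpace ℝ m) :
    y.ofLp ⬝ᵥ (S *ᵥ y.ofLp) ≤ ‖CFC.sqrt S‖ ^ 2 * ‖y‖ ^ 2 := by
  have hsq : CFC.sqrt S * (CFC.sqrt S)ᴴ = S := by
    have h1 : (CFC.sqrt S)ᴴ = CFC.sqrt S := (CFC.sqrt_nonneg S).isSelfAdjoint
    rw [h1]
    exact CFC.sqrt_mul_sqrt_self S hS.nonneg
  have h1 := l2_opNorm_mulVec (CFC.sqrt S)ᴴ y
  rw [l2_opNorm_conjTranspose] at h1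
  have h2 : y.ofLp ⬝ᵥ (S *ᵥ y.ofLp) = ‖WithLp.toLp 2 ((CFC.sqrt S)ᴴ *ᵥ y.ofLp)‖ ^ 2 := by
    conv_lhs => rw [← hsq]
    rw [dotProduct_mul_conjTranspose_mulVec, EuclideanSpace.real_norm_sq_eq,
      conjTranspose_eq_transpose_of_trivial, mulVec_transpose]
    simp [dotProduct, sq]
  rw [h2, ← mul_pow]
  exact pow_le_pow_left₀ (norm_nonneg _) h1 2

/-! ### Scalar Gaussian summands at a fixed time -/

section Law

variable {Ω : Type*} [MeasurableSpace Ω] {P : Measure Ω}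

/-- A linear functional of an isotropic Gaussian vector is a centred Gaussian variable. -/
theorem hasLaw_dotProduct {m : ℕ} {σ : ℝ} {X : Ω → EuclideanSpace ℝ (Fin m)}
    (hX : HasLaw X (multivariateGaussian 0 (σ ^ 2 • (1 : Matrix (Fin m) (Fin m) ℝ))) P)
    (c : Fin m → ℝ) :
    HasLaw (fun ω => c ⬝ᵥ (X ω).ofLp) (gaussianReal 0 (σ ^ 2 * (c ⬝ᵥ c)).toNNReal) P := by
  set S : Matrix (Fin m) (Fin m) ℝ := σ ^ 2 • 1 with hSdef
  have hS : S.PosSemidef := Matrix.PosSemidef.one.smul (sq_nonneg σ)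
  have hfun : (fun z : EuclideanSpace ℝ (Fin m) => c ⬝ᵥ z.ofLp) =
      fun z => innerSL ℝ (WithLp.toLp 2 c) z := by
    funext z
    simp [PiLp.inner_apply, dotProduct, mul_comm]
  have h : HasLaw (fun z : EuclideanSpace ℝ (Fin m) => c ⬝ᵥ z.ofLp)
      (gaussianReal 0 (σ ^ 2 * (c ⬝ᵥ c)).toNNReal) (multivariateGaussian 0 S) := by
    rw [hfun]
    refine ⟨by fun_prop, ?_⟩
    have hvar := covarianceBilin_multivariateGaussian (μ := 0) hS (WithLp.toLp 2 c) (WithLp.toLp 2 c)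
    rw [covarianceBilin_self IsGaussian.memLp_two_id] at hvar
    refine (IsGaussian.map_eq_gaussianReal (innerSL ℝ (WithLp.toLp 2 c))).trans ?_
    congr 1
    · exact (ContinuousLinearMap.integral_comp_id_comm IsGaussian.integrable_id
        (innerSL ℝ (WithLp.toLp 2 c))).trans (by simp)
    · congr 1
      refine Eq.trans ?_ (hvar.trans ?_)
      · rfl
      · simp [hSdef, smul_mulVec]
  exact h.comp hX

end Law

/-- The sources of randomness of a rollout on which `w_k` (index `none`) and `z_k` depend: the
initial state, the input at time `k`, and the inputs and noises before time `k`. -/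
abbrev PastIndex (k : ℕ) : Type := Option (Unit ⊕ (Unit ⊕ (Fin k ⊕ Fin k)))

/-- The source of randomness in rollout `i` with a given index. -/
def pastSource {N T : ℕ} (k : Fin T) : Fin N × PastIndex k → Source N T
  | (i, none) => .noise i k
  | (i, some (.inl _)) => .init i
  | (i, some (.inr (.inl _))) => .input i k
  | (i, some (.inr (.inr (.inl l)))) => .input i ⟨l, l.2.trans k.2⟩
  | (i, some (.inr (.inr (.inr l)))) => .noise i ⟨l, l.2.trans k.2⟩

/-- Past inputs and noises carry an index `l < k`, so they never coincide with `u_k` or `w_k`. This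
is what makes `w_k` independent of `z_k`. -/
theorem pastSource_injective {N T : ℕ} (k : Fin T) :
    Function.Injective (pastSource (N := N) k) := by
  rintro ⟨i, _ | _ | _ | l | l⟩ ⟨j, _ | _ | _ | m | m⟩ h <;>
    simp only [pastSource, Source.noise.injEq, Source.init.injEq, Source.input.injEq,
      reduceCtorEq, Fin.ext_iff] at h <;>
    first
    | (obtain ⟨h1, h2⟩ := h; have := l.2; omega)
    | (obtain ⟨h1, h2⟩ := h; have := m.2; omega)
    | (obtain ⟨h1, h2⟩ := h; obtain rfl := Fin.ext h1; obtain rfl := Fin.ext h2; rfl)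
    | (obtain ⟨h1, h2⟩ := h; obtain rfl := Fin.ext h1; rfl)
    | (obtain rfl := Fin.ext h; rfl)

/-- The coefficients of the linear functionals `x ⬝ w_k` (index `none`) and `y ⬝ z_k` (all other
indices) with respect to the sources of randomness. -/
def pastCoeff {N T n p : ℕ} (A : ℕ → Matrix (Fin n) (Fin n) ℝ) (B : ℕ → Matrix (Fin n) (Fin p) ℝ)
    (x : Fin n → ℝ) (y : Fin n ⊕ Fin p → ℝ) (k : Fin T) :
    (c : Fin N × PastIndex k) → (Fin ((pastSource k c).dim n p) → ℝ)
  | (_, none) => x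
  | (_, some (.inl _)) => (y ∘ Sum.inl) ᵥ* transition A k 0
  | (_, some (.inr (.inl _))) => y ∘ Sum.inr
  | (_, some (.inr (.inr (.inl l)))) => (y ∘ Sum.inl) ᵥ* (transition A k (l + 1) * B l)
  | (_, some (.inr (.inr (.inr l)))) => (y ∘ Sum.inl) ᵥ* transition A k (l + 1)

/-- The variances of the summands of `x ⬝ w_k` (index `none`) and `y ⬝ z_k` (all other
indices). -/
def pastVar {n p : ℕ} (A : ℕ → Matrix (Fin n) (Fin n) ℝ) (B : ℕ → Matrix (Fin n) (Fin p) ℝ)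
    (σx σu σw : ℝ) (x : Fin n → ℝ) (y : Fin n ⊕ Fin p → ℝ) (k : ℕ) : PastIndex k → ℝ
  | none => σw ^ 2 * (x ⬝ᵥ x)
  | some (.inl _) => σx ^ 2 *
      (((y ∘ Sum.inl) ᵥ* transition A k 0) ⬝ᵥ ((y ∘ Sum.inl) ᵥ* transition A k 0))
  | some (.inr (.inl _)) => σu ^ 2 * ((y ∘ Sum.inr) ⬝ᵥ (y ∘ Sum.inr))
  | some (.inr (.inr (.inl l))) => σu ^ 2 *
      (((y ∘ Sum.inl) ᵥ* (transition A k (l + 1) * B l)) ⬝ᵥ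
        ((y ∘ Sum.inl) ᵥ* (transition A k (l + 1) * B l)))
  | some (.inr (.inr (.inr l))) => σw ^ 2 *
      (((y ∘ Sum.inl) ᵥ* transition A k (l + 1)) ⬝ᵥ ((y ∘ Sum.inl) ᵥ* transition A k (l + 1)))

theorem pastVar_nonneg {n p : ℕ} (A : ℕ → Matrix (Fin n) (Fin n) ℝ)
    (B : ℕ → Matrix (Fin n) (Fin p) ℝ) (σx σu σw : ℝ) (x : Fin n → ℝ) (y : Fin n ⊕ Fin p → ℝ)
    (k : ℕ) (j : PastIndex k) : 0 ≤ pastVar A B σx σu σw x y k j := by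
  have h : ∀ {m : ℕ} (c : Fin m → ℝ), 0 ≤ c ⬝ᵥ c := fun c =>
    Finset.sum_nonneg fun i _ => mul_self_nonneg (c i)
  rcases j with _ | _ | _ | l | l <;> exact mul_nonneg (sq_nonneg _) (h _)

theorem sum_pastVar_some {n p : ℕ} (A : ℕ → Matrix (Fin n) (Fin n) ℝ)
    (B : ℕ → Matrix (Fin n) (Fin p) ℝ) (σx σu σw : ℝ) (x : Fin n → ℝ) (y : Fin n ⊕ Fin p → ℝ)
    (k : ℕ) : ∑ j, pastVar A B σx σu σw x y k (some j) = y ⬝ᵥ (covZ A B σx σu σw k *ᵥ y) := by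
  rw [dotProduct_covZ_mulVec]
  simp [Fintype.sum_sum_type, pastVar]

/-! ### Cross matrices and their tail bounds -/

section Rollouts

variable {n p N T : ℕ} {Ω : Type*}
  {A : ℕ → Matrix (Fin n) (Fin n) ℝ} {B : ℕ → Matrix (Fin n) (Fin p) ℝ}
  {x₀ : Fin N → Ω → EuclideanSpace ℝ (Fin n)} {u : Fin N → ℕ → Ω → EuclideanSpace ℝ (Fin p)}
  {w : Fin N → ℕ → Ω → EuclideanSpace ℝ (Fin n)}

/-- The state-input pair `z_k^i`. -/
def stateInput (A : ℕ → Matrix (Fin n) (Fin n) ℝ) (B : ℕ → Matrix (Fin n) (Fin p) ℝ)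
    (x₀ : Fin N → Ω → EuclideanSpace ℝ (Fin n)) (u : Fin N → ℕ → Ω → EuclideanSpace ℝ (Fin p))
    (w : Fin N → ℕ → Ω → EuclideanSpace ℝ (Fin n)) (i : Fin N) (k : ℕ) (ω : Ω) :
    Fin n ⊕ Fin p → ℝ :=
  Sum.elim (state A B (x₀ i ω) (fun k => u i k ω) (fun k => w i k ω) k) (u i k ω).ofLp

/-- The scalar Gaussian summands of `x ⬝ w_k^i` (index `none`) and `y ⬝ z_k^i` (all other
indices). -/
noncomputable def pastTerm (A : ℕ → Matrix (Fin n) (Fin n) ℝ) (B : ℕ → Matrix (Fin n) (Fin p) ℝ)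
    (x₀ : Fin N → Ω → EuclideanSpace ℝ (Fin n)) (u : Fin N → ℕ → Ω → EuclideanSpace ℝ (Fin p))
    (w : Fin N → ℕ → Ω → EuclideanSpace ℝ (Fin n)) (x : Fin n → ℝ) (y : Fin n ⊕ Fin p → ℝ)
    (k : Fin T) (i : Fin N) (j : PastIndex k) (ω : Ω) : ℝ :=
  pastCoeff A B x y k (i, j) ⬝ᵥ (Source.vec x₀ u w (pastSource k (i, j)) ω).ofLp

theorem sum_pastTerm_some (x : Fin n → ℝ) (y : Fin n ⊕ Fin p → ℝ) (k : Fin T) (i : Fin N) (ω : Ω) :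
    ∑ j, pastTerm A B x₀ u w x y k i (some j) ω = y ⬝ᵥ stateInput A B x₀ u w i k ω := by
  rw [stateInput, dotProduct_state_input]
  simp only [Fintype.sum_sum_type, Finset.univ_unique, Finset.sum_singleton]
  rfl

/-- The sum over the rollouts of the outer products `w_k^i (z_k^i)ᵀ`. -/
def crossMatrix (A : ℕ → Matrix (Fin n) (Fin n) ℝ) (B : ℕ → Matrix (Fin n) (Fin p) ℝ)
    (x₀ : Fin N → Ω → EuclideanSpace ℝ (Fin n)) (u : Fin N → ℕ → Ω → EuclideanSpace ℝ (Fin p))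
    (w : Fin N → ℕ → Ω → EuclideanSpace ℝ (Fin n)) (k : ℕ) (ω : Ω) :
    Matrix (Fin n) (Fin n ⊕ Fin p) ℝ :=
  ∑ i, vecMulVec (w i k ω).ofLp (stateInput A B x₀ u w i k ω)

theorem dotProduct_crossMatrix_mulVec (x : Fin n → ℝ) (y : Fin n ⊕ Fin p → ℝ) (k : Fin T) (ω : Ω) :
    x ⬝ᵥ (crossMatrix A B x₀ u w k ω *ᵥ y) =
      ∑ i, pastTerm A B x₀ u w x y k i none ω * ∑ j, pastTerm A B x₀ u w x y k i (some j) ω := by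
  rw [crossMatrix, Matrix.sum_mulVec, dotProduct_sum]
  refine Finset.sum_congr rfl fun i _ => ?_
  rw [sum_pastTerm_some, vecMulVec_mulVec, dotProduct_comm y, op_smul_eq_smul, dotProduct_smul,
    smul_eq_mul, mul_comm]
  rfl

/-- Column `(i, j)` belongs to time `T - 1 - j`, so reversing the time index matches both sums. -/
theorem batchW_mul_batchQ_mul_batchZ (q : ℕ → ℝ) (ω : Ω) :
    batchW T (fun i k => w i k ω) * batchQ N T q *
        (batchZ T A B (fun i => x₀ i ω) (fun i k => u i k ω) (fun i k => w i k ω))ᴴ =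
      ∑ k : Fin T, q k • crossMatrix A B x₀ u w k ω := by
  rw [← Equiv.sum_comp Fin.revPerm]
  ext a b
  rw [mul_apply, batchQ]
  simp only [mul_diagonal, Matrix.sum_apply, Matrix.smul_apply, crossMatrix,
    Fintype.sum_prod_type, conjTranspose_apply, batchW, batchZ, of_apply, star_trivial,
    Fin.revPerm_apply, vecMulVec_apply, smul_eq_mul, stateInput, Finset.mul_sum]
  rw [Finset.sum_comm]
  refine Finset.sum_congr rfl fun k _ => Finset.sum_congr rfl fun i _ => ?_
  ring

variable [MeasurableSpace Ω] {P : Measure Ω} {σx σu σw : ℝ}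

theorem hasLaw_pastTerm (hdata : IsRolloutData P T σx σu σw x₀ u w) (x : Fin n → ℝ)
    (y : Fin n ⊕ Fin p → ℝ) (k : Fin T) (i : Fin N) (j : PastIndex k) :
    HasLaw (pastTerm A B x₀ u w x y k i j)
      (gaussianReal 0 (pastVar A B σx σu σw x y k j).toNNReal) P := by
  rcases j with _ | _ | _ | l | l
  · exact hasLaw_dotProduct (hdata.noise_law i k k.2) _
  · exact hasLaw_dotProduct (hdata.init_law i) _
  · exact hasLaw_dotProduct (hdata.input_law i k k.2) _
  · exact hasLaw_dotProduct (hdata.input_law i l (l.2.trans k.2)) _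
  · exact hasLaw_dotProduct (hdata.noise_law i l (l.2.trans k.2)) _

theorem aemeasurable_vec (hdata : IsRolloutData P T σx σu σw x₀ u w) (s : Source N T) :
    AEMeasurable (Source.vec x₀ u w s) P := by
  rcases s with i | ⟨i, k⟩ | ⟨i, k⟩
  · exact (hdata.init_law i).aemeasurable
  · exact (hdata.input_law i k k.2).aemeasurable
  · exact (hdata.noise_law i k k.2).aemeasurable

theorem iIndepFun_pastTerm (hdata : IsRolloutData P T σx σu σw x₀ u w) (x : Fin n → ℝ)
    (y : Fin n ⊕ Fin p → ℝ) (k : Fin T) :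
    iIndepFun (fun c : Fin N × PastIndex k => pastTerm A B x₀ u w x y k c.1 c.2) P := by
  have h := hdata.indep.precomp (pastSource_injective k)
  refine h.comp₀ (fun c z => pastCoeff A B x y k c ⬝ᵥ z.ofLp)
    (fun c => aemeasurable_vec hdata _) fun c => ?_
  have hm : Continuous fun z : EuclideanSpace ℝ (Fin ((pastSource k c).dim n p)) =>
      pastCoeff A B x y k c ⬝ᵥ z.ofLp := by
    unfold dotProduct
    fun_prop
  exact hm.measurable.aemeasurable

/-- Tail bound for the bilinear form of `∑ i, w_k^i (z_k^i)ᵀ` at two vectors of the unit balls. -/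
theorem measure_bilinear_gt_le (hdata : IsRolloutData P T σx σu σw x₀ u w) (hσw : 0 ≤ σw)
    (k : Fin T) (x : EuclideanSpace ℝ (Fin n)) (hx : ‖x‖ ≤ 1)
    (y : EuclideanSpace ℝ (Fin n ⊕ Fin p)) (hy : ‖y‖ ≤ 1) {θ τ : ℝ} (hθ : 0 < θ) (hθ1 : θ < 1)
    (hτ : 0 < τ) :
    P {ω | τ * (σw * ‖CFC.sqrt (covZ A B σx σu σw k)‖) <
        x.ofLp ⬝ᵥ (crossMatrix A B x₀ u w k ω *ᵥ y.ofLp)} ≤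
      ENNReal.ofReal (Real.exp (-(θ * τ)) * (√(1 - θ ^ 2))⁻¹ ^ N) := by
  set s := σw * ‖CFC.sqrt (covZ A B σx σu σw k)‖ with hs
  simp only [dotProduct_crossMatrix_mulVec]
  have hm : ∀ i j, AEMeasurable (pastTerm A B x₀ u w x.ofLp y.ofLp k i j) P := fun i j =>
    (hasLaw_pastTerm hdata _ _ k i j).aemeasurable
  refine measure_lt_le_of_chaos (Finset.aemeasurable_fun_sum _ fun i _ =>
    (hm i none).mul (Finset.aemeasurable_fun_sum _ fun j _ => hm i (some j)))
    (by positivity) (fun t ht => ?_) hθ hθ1 hτ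
  have hnone : pastVar A B σx σu σw x.ofLp y.ofLp k none ≤ σw ^ 2 := by
    have h1 : x.ofLp ⬝ᵥ x.ofLp = ‖x‖ ^ 2 := by
      rw [EuclideanSpace.real_norm_sq_eq]
      simp [dotProduct, sq]
    have h2 : ‖x‖ ^ 2 ≤ 1 := pow_le_one₀ (norm_nonneg _) hx
    change σw ^ 2 * (x.ofLp ⬝ᵥ x.ofLp) ≤ σw ^ 2
    rw [h1]
    exact mul_le_of_le_one_right (sq_nonneg _) h2
  have hsome : ∑ j, pastVar A B σx σu σw x.ofLp y.ofLp k (some j) ≤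
      ‖CFC.sqrt (covZ A B σx σu σw k)‖ ^ 2 := by
    rw [sum_pastVar_some]
    refine (dotProduct_mulVec_le_norm_sqrt_sq (covZ_posSemidef A B σx σu σw k) y).trans ?_
    exact mul_le_of_le_one_right (sq_nonneg _) (pow_le_one₀ (norm_nonneg _) hy)
  -- Upper bounds on the variances suffice, as the chaos Laplace transform increases with them.
  have hle : t ^ 2 * pastVar A B σx σu σw x.ofLp y.ofLp k none *
      ∑ j, pastVar A B σx σu σw x.ofLp y.ofLp k (some j) ≤ (t * s) ^ 2 := by
    rw [hs, mul_pow, mul_pow, ← mul_assoc]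
    gcongr
    exact Finset.sum_nonneg fun j _ => pastVar_nonneg A B σx σu σw _ _ _ _
  have hcoe : t ^ 2 * ((pastVar A B σx σu σw x.ofLp y.ofLp k none).toNNReal : ℝ) *
      (∑ j, (pastVar A B σx σu σw x.ofLp y.ofLp k (some j)).toNNReal : NNReal) ≤ (t * s) ^ 2 := by
    push_cast
    simp only [Real.coe_toNNReal _ (pastVar_nonneg A B σx σu σw _ _ _ _)]
    exact hle
  refine (le_of_eq (lintegral_exp_chaos (iIndepFun_pastTerm hdata x.ofLp y.ofLp k)
    (fun i j => hasLaw_pastTerm hdata x.ofLp y.ofLp k i j) (hcoe.trans_lt ht))).trans ?_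
  rw [Fintype.card_fin, ← ENNReal.ofReal_pow (by positivity)]
  refine ENNReal.ofReal_le_ofReal ?_
  have : 0 < √(1 - (t * s) ^ 2) := Real.sqrt_pos.2 (by linarith)
  gcongr

/-- Tail bound for the spectral norm of `∑ i, w_k^i (z_k^i)ᵀ`. -/
theorem measure_norm_crossMatrix_gt_le (hdata : IsRolloutData P T σx σu σw x₀ u w) (hσw : 0 ≤ σw)
    (hn : 1 ≤ n) (k : Fin T) {ε : ℝ} (hε : 0 < ε) (hε2 : ε ≤ 1 / 2)
    (hN : 2 * (2 * (n : ℝ) + p) * Real.log (1 / ε) ≤ N) :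
    P {ω | 4 * σw * √((N : ℝ) * (2 * (n : ℝ) + p) * Real.log (9 / ε)) *
        ‖CFC.sqrt (covZ A B σx σu σw k)‖ < ‖crossMatrix A B x₀ u w k ω‖} ≤
      ENNReal.ofReal ε := by
  set D := n + (n + p) with hD
  have hDc : (D : ℝ) = 2 * (n : ℝ) + p := by rw [hD]; push_cast; ring
  rw [← hDc] at hN ⊢
  set κ := √((N : ℝ) * D * Real.log (9 / ε)) with hκ
  set ρ := ‖CFC.sqrt (covZ A B σx σu σw k)‖ with hρ
  obtain ⟨θ, hθ0, hθ1, hθ⟩ := exists_exponent_net_bound (by omega : 1 ≤ D) hε hε2 hN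
  have hNpos : (0 : ℝ) < N := by
    have h1 : 0 < Real.log (1 / ε) := Real.log_pos (by rw [lt_div_iff₀ hε]; linarith)
    have h2 : (0 : ℝ) < D := by exact_mod_cast (by omega : 0 < D)
    exact lt_of_lt_of_le (by positivity) hN
  have hκpos : 0 < κ := by
    have h1 : 0 < Real.log (9 / ε) := Real.log_pos (by rw [lt_div_iff₀ hε]; linarith)
    have h2 : (0 : ℝ) < D := by exact_mod_cast (by omega : 0 < D)
    exact Real.sqrt_pos.2 (by positivity)
  obtain ⟨C₁, hcard₁, hball₁, hnet₁⟩ := exists_quarter_net (EuclideanSpace ℝ (Fin n))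
  obtain ⟨C₂, hcard₂, hball₂, hnet₂⟩ := exists_quarter_net (EuclideanSpace ℝ (Fin n ⊕ Fin p))
  rw [finrank_euclideanSpace, Fintype.card_fin] at hcard₁
  rw [finrank_euclideanSpace, Fintype.card_sum, Fintype.card_fin, Fintype.card_fin] at hcard₂
  have hsub : {ω | 4 * σw * κ * ρ < ‖crossMatrix A B x₀ u w k ω‖} ⊆
      ⋃ c ∈ C₁ ×ˢ C₂, {ω | 9 / 4 * κ * (σw * ρ) <
        c.1.ofLp ⬝ᵥ (crossMatrix A B x₀ u w k ω *ᵥ c.2.ofLp)} := by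
    intro ω hω
    by_contra hcon
    simp only [Set.mem_iUnion, Set.mem_ofPred_eq, not_exists, not_lt, Finset.mem_product,
      and_imp, Prod.forall] at hcon
    rw [Set.mem_ofPred_eq] at hω
    refine absurd hω (not_lt.2 ?_)
    rw [l2_opNorm_def]
    -- The net factor `16/9` times `9/4` is the constant `4`.
    refine (opNorm_le_of_quarter_nets _ C₂ C₁ hnet₂ hnet₁ (K := 9 / 4 * κ * (σw * ρ))
      (by positivity) fun x hx y hy => ?_).trans (le_of_eq (by ring))
    refine le_trans (le_of_eq ?_) (hcon x y hx hy)
    simp [PiLp.inner_apply, dotProduct, mul_comm]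
  calc _ ≤ _ := measure_mono hsub
    _ ≤ ∑ c ∈ C₁ ×ˢ C₂, P {ω | 9 / 4 * κ * (σw * ρ) <
        c.1.ofLp ⬝ᵥ (crossMatrix A B x₀ u w k ω *ᵥ c.2.ofLp)} := measure_biUnion_finset_le _ _
    _ ≤ ∑ c ∈ C₁ ×ˢ C₂, ENNReal.ofReal
        (Real.exp (-(θ * (9 / 4 * κ))) * (√(1 - θ ^ 2))⁻¹ ^ N) := by
      refine Finset.sum_le_sum fun c hc => ?_
      rw [Finset.mem_product] at hc
      exact measure_bilinear_gt_le hdata hσw k c.1 (hball₁ _ hc.1) c.2 (hball₂ _ hc.2) hθ0 hθ1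
        (by positivity)
    _ = ENNReal.ofReal ((C₁.card * C₂.card : ℕ) *
        (Real.exp (-(θ * (9 / 4 * κ))) * (√(1 - θ ^ 2))⁻¹ ^ N)) := by
      rw [Finset.sum_const, Finset.card_product, nsmul_eq_mul,
        ENNReal.ofReal_mul (Nat.cast_nonneg _), ENNReal.ofReal_natCast]
    _ ≤ ENNReal.ofReal ε := by
      refine ENNReal.ofReal_le_ofReal (le_trans ?_ hθ)
      gcongr
      calc ((C₁.card * C₂.card : ℕ) : ℝ) ≤ ((9 ^ n * 9 ^ (n + p) : ℕ) : ℝ) := by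
            exact_mod_cast Nat.mul_le_mul hcard₁ hcard₂
        _ = 9 ^ D := by rw [hD, ← pow_add]; push_cast; rfl

end Rollouts

end AuxSysId

/-! ### Union bound over time -/

theorem proposition3 {n p N T : ℕ}
    {Ω : Type*} [MeasurableSpace Ω] (P : Measure Ω) [IsProbabilityMeasure P]
    (A : ℕ → Matrix (Fin n) (Fin n) ℝ) (B : ℕ → Matrix (Fin n) (Fin p) ℝ)
    (σx σu σw : ℝ) (hσx : 0 ≤ σx) (hσu : 0 ≤ σu) (hσw : 0 ≤ σw)
    (x₀ : Fin N → Ω → EuclideanSpace ℝ (Fin n))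
    (u : Fin N → ℕ → Ω → EuclideanSpace ℝ (Fin p))
    (w : Fin N → ℕ → Ω → EuclideanSpace ℝ (Fin n))
    (hdata : AuxSysId.IsRolloutData P T σx σu σw x₀ u w)
    (q : ℕ → ℝ) (hq : ∀ k < T, 0 ≤ q k)
    (δ : ℝ) (hδ : 0 < δ) (hδT : T = 1 → δ ≤ 1 / 2)
    (hN : (4 * (n : ℝ) + 2 * (p : ℝ)) * Real.log ((T : ℝ) / δ) ≤ (N : ℝ)) :
    ENNReal.ofReal (1 - δ) ≤
      P {ω | ‖AuxSysId.batchW T (fun i k => w i k ω) * AuxSysId.batchQ N T q *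
            (AuxSysId.batchZ T A B (fun i => x₀ i ω) (fun i k => u i k ω)
              (fun i k => w i k ω))ᴴ‖
          ≤ 4 * σw * √((N : ℝ) * (2 * (n : ℝ) + (p : ℝ)) * Real.log (9 * (T : ℝ) / δ)) *
            ∑ k ∈ Finset.range T, q k * ‖CFC.sqrt (AuxSysId.covZ A B σx σu σw k)‖} := by
  simp only [AuxSysId.batchW_mul_batchQ_mul_batchZ]
  set G := {ω | ‖∑ k : Fin T, q k • AuxSysId.crossMatrix A B x₀ u w k ω‖ ≤
    4 * σw * √((N : ℝ) * (2 * (n : ℝ) + (p : ℝ)) * Real.log (9 * (T : ℝ) / δ)) *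
      ∑ k ∈ Finset.range T, q k * ‖CFC.sqrt (AuxSysId.covZ A B σx σu σw k)‖} with hG
  set κ := √((N : ℝ) * (2 * (n : ℝ) + (p : ℝ)) * Real.log (9 * (T : ℝ) / δ)) with hκ
  -- Subadditivity on `G ∪ Gᶜ` requires no measurability of `G`.
  suffices h : P Gᶜ ≤ ENNReal.ofReal δ by
    rw [ENNReal.ofReal_sub _ hδ.le, ENNReal.ofReal_one, tsub_le_iff_right,
      ← measure_univ (μ := P), ← Set.union_compl_self G]
    exact (measure_union_le _ _).trans (add_le_add le_rfl h)
  have hsub : Gᶜ ⊆ ⋃ k : Fin T, {ω | 4 * σw * κ *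
      ‖CFC.sqrt (AuxSysId.covZ A B σx σu σw k)‖ < ‖AuxSysId.crossMatrix A B x₀ u w k ω‖} := by
    intro ω hω
    by_contra hcon
    simp only [Set.mem_iUnion, Set.mem_ofPred_eq, not_exists, not_lt] at hcon
    refine hω ?_
    rw [hG, Set.mem_ofPred_eq, ← Fin.sum_univ_eq_sum_range
      (fun k => q k * ‖CFC.sqrt (AuxSysId.covZ A B σx σu σw k)‖), Finset.mul_sum]
    refine (norm_sum_le _ _).trans (Finset.sum_le_sum fun k _ => ?_)
    rw [norm_smul, Real.norm_of_nonneg (hq k k.2), mul_left_comm]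
    exact mul_le_mul_of_nonneg_left (hcon k) (hq k k.2)
  rcases le_or_gt 1 δ with hδ1 | hδ1
  · exact prob_le_one.trans (by simpa using hδ1)
  rcases Nat.eq_zero_or_pos T with hT | hT
  · subst hT
    have : Gᶜ = ∅ := Set.subset_eq_empty hsub (by simp)
    simp [this]
  -- For `n = 0` the matrices vanish; otherwise `2n + p ≥ 1`, as the exponent estimate needs.
  rcases Nat.eq_zero_or_pos n with hn | hn
  · have hempty : IsEmpty (Fin n) := by rw [hn]; infer_instance
    have : Gᶜ = ∅ := Set.subset_eq_empty hsub (by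
      refine Set.iUnion_eq_empty.2 fun k => Set.eq_empty_of_forall_notMem fun ω hω => ?_
      have h0 : AuxSysId.crossMatrix A B x₀ u w k ω = 0 := Subsingleton.elim _ _
      rw [Set.mem_ofPred_eq, h0, norm_zero] at hω
      exact absurd hω (not_lt.2 (by positivity)))
    simp [this]
  have hTpos : (0 : ℝ) < T := by exact_mod_cast hT
  -- For `T ≥ 2` this follows from `δ < 1`; only `T = 1` needs the extra hypothesis.
  have hε2 : δ / T ≤ 1 / 2 := by
    rw [div_le_iff₀ hTpos]
    rcases (by omega : T = 1 ∨ 2 ≤ T) with h | h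
    · rw [h]
      simpa using hδT h
    · have : (2 : ℝ) ≤ T := by exact_mod_cast h
      linarith
  have hbound : ∀ k : Fin T, P {ω | 4 * σw * κ *
      ‖CFC.sqrt (AuxSysId.covZ A B σx σu σw k)‖ < ‖AuxSysId.crossMatrix A B x₀ u w k ω‖} ≤
      ENNReal.ofReal (δ / T) := by
    intro k
    have h := AuxSysId.measure_norm_crossMatrix_gt_le (A := A) (B := B) hdata hσw hn k
      (div_pos hδ hTpos) hε2 (by
        rw [one_div_div]
        calc _ = _ := by ring
          _ ≤ _ := hN)
    rwa [show 9 / (δ / T) = 9 * (T : ℝ) / δ by field_simp] at h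
  calc P Gᶜ ≤ _ := measure_mono hsub
    _ ≤ _ := measure_iUnion_fintype_le P _
    _ ≤ ∑ _k : Fin T, ENNReal.ofReal (δ / T) := Finset.sum_le_sum fun k _ => hbound k
    _ = ENNReal.ofReal δ := by
      rw [Finset.sum_const, Finset.card_univ, Fintype.card_fin, nsmul_eq_mul,
        ← ENNReal.ofReal_natCast, ← ENNReal.ofReal_mul (Nat.cast_nonneg _)]
      congr 1
      field_simp
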